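/- Let ${\bf t} = t_0t_1t_2\cdots = 01101001\cdots$ be the Thue–Morse word, where $t_i\in\{0,1\}$ is the sum of the binary digits of $i$ modulo $2$. For $n \ge 0$ let $c(n)$ be the cyclic complexity of ${\bf t}$, i.e., the number of length-$n$ factors (blocks $t_i t_{i+1}\cdots t_{i+n-1}$, $i \ge 0$) of ${\bf t}$, where factors that are cyclic rotations of each other are counted only once. Then $c(n) \le 2n-4$ for all $n \ge 3$. -/

import Mathlib

/-- The Thue–Morse word `t = 01101001⋯` over the alphabet `{0, 1}`: its letter in position `i`
(positions start at `0`) is the sum of the binary digits of `i`, modulo `2`. -/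
def thueMorse (i : ℕ) : Fin 2 :=
  ⟨(Nat.digits 2 i).sum % 2, Nat.mod_lt _ Nat.two_pos⟩

/-- The length-`n` block `x[i..i+n-1]` of the infinite word `x` starting in position `i`. -/
def wordBlock {α : Type*} (x : ℕ → α) (i n : ℕ) : List α :=
  List.ofFn fun j : Fin n => x (i + j)

/-- The set of length-`n` factors of the infinite word `x`. -/
def wordFactors {α : Type*} (x : ℕ → α) (n : ℕ) : Set (List α) :=
  {w | ∃ i : ℕ, w = wordBlock x i n}

/-- The length-`n` factors of `x` up to cyclic rotation: `Cycle α` is the quotient of `List α`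
by the relation of being a rotation of one another. -/
def cyclicFactors {α : Type*} (x : ℕ → α) (n : ℕ) : Set (Cycle α) :=
  (fun w : List α => (w : Cycle α)) '' wordFactors x n

/-- Over a finite alphabet there are finitely many factors of each length up to rotation, so
that the cardinality below is a genuine one. -/
theorem cyclicFactors_finite {α : Type*} [Finite α] (x : ℕ → α) (n : ℕ) :
    (cyclicFactors x n).Finite := by
  refine ((List.finite_length_eq α n).subset ?_).image _
  rintro w ⟨i, rfl⟩
  simp [wordBlock]

/-- The cyclic complexity of an infinite word `x` over a finite alphabet: the number of
length-`n` factors of `x`, where factors that agree up to a cyclic shift are counted once. -/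
noncomputable def cyclicComplexity {α : Type*} [Finite α] (x : ℕ → α) (n : ℕ) : ℕ :=
  (cyclicFactors x n).ncard

/-! Let `B_d(j)` count the factors of length `j + 1` whose last letter is the first plus `d`, so
there are `B_0(j) + B_1(j)` factors of that length. Undoing the morphism 0 ↦ 01, 1 ↦ 10 gives
`B_d(2j) ≤ 2 B_d(j)` and `B_d(2j+1) ≤ B_{d+1}(j) + B_{d+1}(j+1)`. Hence `B_d(j) ≤ 2j`, and `B_0(2) ≤
2` improves the sum to `B_0(j) + B_1(j) ≤ 10j/3` for `j ≥ 2`.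

For even length, `c(2m) ≤ c(m) + B_1(m)` closes an induction. For odd length the morphism is undone
twice, according to the position mod 4: `c(4j+3)` and `c(4j+1)` are bounded by `B_0(j) + B_1(j)`
plus `B_1(j) + B_0(j+1)`, respectively `B_0(j) + B_1(j+1)`. Only length `4j+1` needs the 10/3 bound.
Lengths 3, 4, 5, 13 are computed. -/

theorem Fin.two_add_one_add_one (x : Fin 2) : x + 1 + 1 = x := by
  revert x; decide

theorem Fin.two_eq_or_eq_add_one (x y : Fin 2) : x = y ∨ x = y + 1 := by
  revert x y; decide

theorem thueMorse_two_mul (i : ℕ) : thueMorse (2 * i) = thueMorse i := by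
  rcases Nat.eq_zero_or_pos i with rfl | h
  · rfl
  · have := Nat.digits_add_two_add_one 0 (2 * i - 1)
    have h2 : 2 * i - 1 + 1 = 2 * i := by omega
    rw [h2] at this
    simp only [Nat.zero_add] at this
    apply Fin.ext
    simp only [thueMorse, this]
    simp

theorem thueMorse_two_mul_add_one (i : ℕ) : thueMorse (2 * i + 1) = thueMorse i + 1 := by
  have := Nat.digits_add_two_add_one 0 (2 * i)
  simp only [Nat.zero_add] at this
  have h2 : (2 * i + 1) / 2 = i := by omega
  have h3 : (2 * i + 1) % 2 = 1 := by omega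
  apply Fin.ext
  simp only [thueMorse, this, h2, h3, Fin.val_add, List.sum_cons]
  simp [Nat.add_comm]

theorem thueMorse_two_pow_mul_add (k q r : ℕ) (hr : r < 2 ^ k) :
    thueMorse (2 ^ k * q + r) = thueMorse q + thueMorse r := by
  induction k generalizing r with
  | zero =>
    obtain rfl : r = 0 := by simpa using hr
    have : thueMorse 0 = 0 := rfl
    simp [this]
  | succ k ih =>
    rw [pow_succ] at hr
    obtain ⟨s, rfl | rfl⟩ := Nat.even_or_odd' r
    · rw [show 2 ^ (k + 1) * q + 2 * s = 2 * (2 ^ k * q + s) by ring, thueMorse_two_mul,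
        thueMorse_two_mul, ih s (by omega)]
    · rw [show 2 ^ (k + 1) * q + (2 * s + 1) = 2 * (2 ^ k * q + s) + 1 by ring,
        thueMorse_two_mul_add_one, thueMorse_two_mul_add_one, ih s (by omega), add_assoc]

/-! ### Blocks and their desubstitution -/

section Blocks

variable {α : Type*} (x : ℕ → α)

theorem wordBlock_zero (i : ℕ) : wordBlock x i 0 = [] := rfl

theorem wordBlock_succ (i n : ℕ) : wordBlock x i (n + 1) = x i :: wordBlock x (i + 1) n := by
  simp [wordBlock, List.ofFn_succ, Nat.add_comm, Nat.add_left_comm]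

theorem wordBlock_succ' (i n : ℕ) :
    wordBlock x i (n + 1) = wordBlock x i n ++ [x (i + n)] := by
  simp only [wordBlock, List.ofFn_succ', List.concat_eq_append]
  rfl

theorem wordBlock_congr {y : ℕ → α} {i i' n : ℕ} (h : ∀ k < n, x (i + k) = y (i' + k)) :
    wordBlock x i n = wordBlock y i' n := by
  simp only [wordBlock]
  congr 1
  funext k
  exact h k k.2

theorem wordFactors_finite [Finite α] (n : ℕ) : (wordFactors x n).Finite := by
  refine (List.finite_length_eq α n).subset ?_
  rintro w ⟨i, rfl⟩
  simp [wordBlock]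

end Blocks

/-- The Thue–Morse morphism `0 ↦ 01`, `1 ↦ 10`. -/
def morseMap (w : List (Fin 2)) : List (Fin 2) := w.flatMap fun a => [a, a + 1]

theorem morseMap_nil : morseMap [] = [] := rfl

theorem morseMap_cons (a : Fin 2) (w : List (Fin 2)) :
    morseMap (a :: w) = a :: (a + 1) :: morseMap w := rfl

theorem morseMap_append (v w : List (Fin 2)) :
    morseMap (v ++ w) = morseMap v ++ morseMap w := by
  simp [morseMap]

theorem morseMap_isRotated {v w : List (Fin 2)} (h : v ~r w) : morseMap v ~r morseMap w := by
  obtain ⟨n, rfl⟩ := h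
  induction n with
  | zero => rw [List.rotate_zero]
  | succ n ih =>
    refine ih.trans ?_
    rw [← List.rotate_rotate]
    rcases v.rotate n with _ | ⟨a, l⟩
    · exact List.IsRotated.refl _
    · simp only [List.rotate_cons_succ, List.rotate_zero, morseMap_append, morseMap_cons]
      exact List.isRotated_append (l := [a, a + 1])

theorem wordBlock_even_even (q m : ℕ) :
    wordBlock thueMorse (2 * q) (2 * m) = morseMap (wordBlock thueMorse q m) := by
  induction m generalizing q with
  | zero => rfl
  | succ m ih =>
    rw [show 2 * (m + 1) = 2 * m + 1 + 1 by ring, wordBlock_succ, wordBlock_succ, wordBlock_succ,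
      morseMap_cons, thueMorse_two_mul, thueMorse_two_mul_add_one, ← ih]
    rfl

theorem wordBlock_even_odd (q m : ℕ) : wordBlock thueMorse (2 * q) (2 * m + 1) =
    morseMap (wordBlock thueMorse q m) ++ [thueMorse (q + m)] := by
  rw [wordBlock_succ', wordBlock_even_even, ← mul_add, thueMorse_two_mul]

theorem wordBlock_odd_odd (q m : ℕ) : wordBlock thueMorse (2 * q + 1) (2 * m + 1) =
    (thueMorse q + 1) :: morseMap (wordBlock thueMorse (q + 1) m) := by
  rw [wordBlock_succ, thueMorse_two_mul_add_one, ← wordBlock_even_even]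
  rfl

theorem wordBlock_odd_even (q m : ℕ) : wordBlock thueMorse (2 * q + 1) (2 * (m + 1)) =
    (thueMorse q + 1) :: (morseMap (wordBlock thueMorse (q + 1) m) ++ [thueMorse (q + m + 1)]) := by
  rw [show 2 * (m + 1) = 2 * m + 1 + 1 by ring, wordBlock_succ', wordBlock_odd_odd,
    show 2 * q + 1 + (2 * m + 1) = 2 * (q + m + 1) by ring, thueMorse_two_mul]
  rfl

theorem exists_pos_wordBlock_eq (i n : ℕ) :
    ∃ i', wordBlock thueMorse i n = wordBlock thueMorse (i' + 4) n := by
  -- As `t 3 = 0`, shifting by 3 times a power of 2 beyond the block's end preserves its letters.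
  refine ⟨2 ^ (i + n + 2) * 3 + i - 4, ?_⟩
  have h1 : i + n + 2 < 2 ^ (i + n + 2) := Nat.lt_two_pow_self
  apply wordBlock_congr
  intro k hk
  rw [show 2 ^ (i + n + 2) * 3 + i - 4 + 4 + k = 2 ^ (i + n + 2) * 3 + (i + k) by omega,
    thueMorse_two_pow_mul_add _ _ _ (by omega)]
  have : thueMorse 3 = 0 := by simp [thueMorse]
  rw [this, zero_add]

/-! ### Counting factors by their end letters -/

/-- The factors of length `j + 1` of the Thue–Morse word whose last letter exceeds the first one
by `d`. -/
def borderedFactors (d : Fin 2) (j : ℕ) : Set (List (Fin 2)) :=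
  {w | ∃ i, thueMorse (i + j) = thueMorse i + d ∧ w = wordBlock thueMorse i (j + 1)}

theorem borderedFactors_finite (d : Fin 2) (j : ℕ) : (borderedFactors d j).Finite :=
  (wordFactors_finite thueMorse (j + 1)).subset (by rintro w ⟨i, -, rfl⟩; exact ⟨i, rfl⟩)

theorem Set.ncard_le_of_subset_image_union {α β γ : Type*} {s : Set γ} {a : Set α} {b : Set β}
    (ha : a.Finite) (hb : b.Finite) (f : α → γ) (g : β → γ) (h : s ⊆ f '' a ∪ g '' b) :
    s.ncard ≤ a.ncard + b.ncard :=
  (Set.ncard_le_ncard h ((ha.image f).union (hb.image g))).trans <|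
    (Set.ncard_union_le _ _).trans <|
      add_le_add (Set.ncard_image_le ha) (Set.ncard_image_le hb)

theorem ncard_wordFactors_le (j : ℕ) : (wordFactors thueMorse (j + 1)).ncard ≤
    (borderedFactors 0 j).ncard + (borderedFactors 1 j).ncard := by
  refine Set.ncard_le_of_subset_image_union (borderedFactors_finite 0 j)
    (borderedFactors_finite 1 j) id id ?_
  rintro w ⟨i, rfl⟩
  rcases Fin.two_eq_or_eq_add_one (thueMorse (i + j)) (thueMorse i) with h | h
  · exact Or.inl ⟨_, ⟨i, by simpa using h, rfl⟩, rfl⟩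
  · exact Or.inr ⟨_, ⟨i, h, rfl⟩, rfl⟩

/-- Such a block is an image without its last letter (even position) or its first (odd position);
both keep the difference of the end letters. -/
theorem ncard_borderedFactors_two_mul_le (d : Fin 2) (j : ℕ) :
    (borderedFactors d (2 * j)).ncard ≤ 2 * (borderedFactors d j).ncard := by
  rw [two_mul (Set.ncard _)]
  refine Set.ncard_le_of_subset_image_union (borderedFactors_finite d j)
    (borderedFactors_finite d j) (fun z => (morseMap z).dropLast) (fun z => (morseMap z).tail) ?_
  rintro w ⟨i, hi, rfl⟩
  obtain ⟨q, rfl | rfl⟩ := Nat.even_or_odd' i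
  · refine Or.inl ⟨_, ⟨q, ?_, rfl⟩, ?_⟩
    · rwa [← mul_add, thueMorse_two_mul, thueMorse_two_mul] at hi
    · simp [wordBlock_succ', morseMap_append, morseMap_cons, morseMap_nil,
        wordBlock_even_even, ← mul_add, thueMorse_two_mul]
  · refine Or.inr ⟨_, ⟨q, ?_, rfl⟩, ?_⟩
    · rw [show 2 * q + 1 + 2 * j = 2 * (q + j) + 1 by ring, thueMorse_two_mul_add_one,
        thueMorse_two_mul_add_one, add_right_comm] at hi
      exact add_right_cancel hi
    · rw [wordBlock_odd_odd, wordBlock_succ]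
      rfl

/-- Such a block is a full image, or an image stripped of both end letters; exactly one end is then
complemented. -/
theorem ncard_borderedFactors_two_mul_add_one_le (d : Fin 2) (j : ℕ) :
    (borderedFactors d (2 * j + 1)).ncard ≤
      (borderedFactors (d + 1) j).ncard + (borderedFactors (d + 1) (j + 1)).ncard := by
  refine Set.ncard_le_of_subset_image_union (borderedFactors_finite _ j)
    (borderedFactors_finite _ (j + 1)) morseMap (fun z => (morseMap z).tail.dropLast) ?_
  rintro w ⟨i, hi, rfl⟩
  obtain ⟨q, rfl | rfl⟩ := Nat.even_or_odd' i
  · refine Or.inl ⟨_, ⟨q, ?_, rfl⟩, ?_⟩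
    · rw [show 2 * q + (2 * j + 1) = 2 * (q + j) + 1 by ring, thueMorse_two_mul_add_one,
        thueMorse_two_mul] at hi
      rw [← add_assoc, ← hi, Fin.two_add_one_add_one]
    · rw [← wordBlock_even_even]
      rfl
  · refine Or.inr ⟨_, ⟨q, ?_, rfl⟩, ?_⟩
    · rw [show 2 * q + 1 + (2 * j + 1) = 2 * (q + (j + 1)) by ring, thueMorse_two_mul,
        thueMorse_two_mul_add_one] at hi
      rw [hi, add_assoc, add_comm 1]
    · rw [show 2 * j + 1 + 1 = 2 * (j + 1) by ring, wordBlock_odd_even, wordBlock_succ,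
        wordBlock_succ']
      simp only [morseMap_cons, morseMap_append, morseMap_nil, List.tail_cons]
      rw [← List.cons_append, List.append_cons, List.dropLast_concat]
      simp [Nat.add_assoc, Nat.add_comm]

theorem ncard_borderedFactors_one_le (d : Fin 2) : (borderedFactors d 1).ncard ≤ 2 := by
  have : borderedFactors d 1 ⊆ ({[0, 0 + d], [1, 1 + d]} : Finset (List (Fin 2))) := by
    rintro w ⟨i, hi, rfl⟩
    rw [wordBlock_succ, wordBlock_succ, wordBlock_zero, hi]
    rcases Fin.two_eq_or_eq_add_one (thueMorse i) 0 with h | h <;> simp [h]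
  exact (Set.ncard_le_ncard this (Finset.finite_toSet _)).trans
    ((Set.ncard_coe_finset _).le.trans Finset.card_le_two)

/-- One of two adjacent pairs is the image of a letter, which excludes 000 and 111. -/
theorem ncard_borderedFactors_zero_two_le : (borderedFactors 0 2).ncard ≤ 2 := by
  have : borderedFactors 0 2 ⊆ ({[0, 1, 0], [1, 0, 1]} : Finset (List (Fin 2))) := by
    rintro w ⟨i, hi, rfl⟩
    have h3 : thueMorse (i + 1) = thueMorse i + 1 := by
      obtain ⟨q, rfl | rfl⟩ := Nat.even_or_odd' i
      · rw [thueMorse_two_mul_add_one, thueMorse_two_mul]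
      · rw [show 2 * q + 1 + 2 = 2 * (q + 1) + 1 by ring, thueMorse_two_mul_add_one,
          thueMorse_two_mul_add_one, add_zero] at hi
        rw [show 2 * q + 1 + 1 = 2 * (q + 1) by ring, thueMorse_two_mul,
          thueMorse_two_mul_add_one, Fin.two_add_one_add_one]
        exact add_right_cancel hi
    rw [wordBlock_succ, wordBlock_succ, wordBlock_succ, wordBlock_zero, hi, h3]
    rcases Fin.two_eq_or_eq_add_one (thueMorse i) 0 with h | h <;> simp [h]
  exact (Set.ncard_le_ncard this (Finset.finite_toSet _)).trans
    ((Set.ncard_coe_finset _).le.trans Finset.card_le_two)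

theorem ncard_borderedFactors_le (d : Fin 2) (j : ℕ) (hj : 1 ≤ j) :
    (borderedFactors d j).ncard ≤ 2 * j := by
  induction j using Nat.strong_induction_on generalizing d with
  | _ j ih =>
    rcases Nat.lt_or_ge j 2 with h | h
    · obtain rfl : j = 1 := by omega
      exact ncard_borderedFactors_one_le d
    · obtain ⟨k, rfl | rfl⟩ := Nat.even_or_odd' j
      · have := ncard_borderedFactors_two_mul_le d k
        have := ih k (by omega) d (by omega)
        omega
      · have := ncard_borderedFactors_two_mul_add_one_le d k
        have := ih k (by omega) (d + 1) (by omega)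
        have := ih (k + 1) (by omega) (d + 1) (by omega)
        omega

theorem three_mul_ncard_borderedFactors_add_le (j : ℕ) (hj : 2 ≤ j) :
    3 * ((borderedFactors 0 j).ncard + (borderedFactors 1 j).ncard) ≤ 10 * j := by
  induction j using Nat.strong_induction_on with
  | _ j ih =>
    obtain ⟨k, rfl | rfl⟩ := Nat.even_or_odd' j
    · have h0 := ncard_borderedFactors_two_mul_le 0 k
      have h1 := ncard_borderedFactors_two_mul_le 1 k
      rcases Nat.lt_or_ge k 2 with h | h
      · obtain rfl : k = 1 := by omega
        have := ncard_borderedFactors_one_le 1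
        have := ncard_borderedFactors_zero_two_le
        norm_num at *
        omega
      · have := ih k (by omega) h
        omega
    · have h0 := ncard_borderedFactors_two_mul_add_one_le 0 k
      have h1 := ncard_borderedFactors_two_mul_add_one_le 1 k
      rw [show (0 + 1 : Fin 2) = 1 from rfl] at h0
      rw [show (1 + 1 : Fin 2) = 0 from rfl] at h1
      have h3 := ih (k + 1) (by omega) (by omega)
      rcases Nat.lt_or_ge k 2 with h | h
      -- Integrality matters: the bound 20/3 at 2 rounds down to 6, and 4 + 6 = 10.
      · obtain rfl : k = 1 := by omega
        have := ncard_borderedFactors_one_le 1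
        have := ncard_borderedFactors_one_le 0
        omega
      · have := ih k (by omega) h
        omega

/-- The target is `2(4j+1) - 4`. The estimate `10j/3 + 2j + 2(j+1)` meets it from `j = 6` on; below
that the recursions do, except at 3, where they give 24 > 22. -/
theorem ncard_borderedFactors_sum_le (j : ℕ) (h1 : 2 ≤ j) (h3 : j ≠ 3) :
    2 * (borderedFactors 0 j).ncard + (borderedFactors 1 j).ncard +
      (borderedFactors 1 (j + 1)).ncard ≤ 8 * j - 2 := by
  rcases Nat.lt_or_ge j 6 with h | h
  · have a01 := ncard_borderedFactors_one_le 0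
    have a11 := ncard_borderedFactors_one_le 1
    have a02 := ncard_borderedFactors_zero_two_le
    have a12 := ncard_borderedFactors_two_mul_le 1 1
    have a03 := ncard_borderedFactors_two_mul_add_one_le 0 1
    have a13 := ncard_borderedFactors_two_mul_add_one_le 1 1
    have a04 := ncard_borderedFactors_two_mul_le 0 2
    have a14 := ncard_borderedFactors_two_mul_le 1 2
    have a05 := ncard_borderedFactors_two_mul_add_one_le 0 2
    have a15 := ncard_borderedFactors_two_mul_add_one_le 1 2
    have a16 := ncard_borderedFactors_two_mul_le 1 3
    simp only [show (0 + 1 : Fin 2) = 1 from rfl, show (1 + 1 : Fin 2) = 0 from rfl] at *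
    norm_num at *
    interval_cases j
    · norm_num; omega
    · omega
    · norm_num; omega
    · norm_num; omega
  · have := three_mul_ncard_borderedFactors_add_le j h1
    have := ncard_borderedFactors_le 0 j (by omega)
    have := ncard_borderedFactors_le 1 (j + 1) (by omega)
    omega

/-! ### Cyclic words of odd length -/

theorem List.coe_cycle_append_comm {α : Type*} (v w : List α) :
    ((v ++ w : List α) : Cycle α) = ((w ++ v : List α) : Cycle α) :=
  Cycle.coe_eq_coe.2 List.isRotated_append

/-- The cyclic word of odd length obtained by inserting the letter `b` after the image of `w`
under the Thue–Morse morphism. -/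
def oddMorseCycle (w : List (Fin 2)) (b : Fin 2) : Cycle (Fin 2) :=
  ((morseMap w ++ [b] : List (Fin 2)) : Cycle (Fin 2))

/-- The word ends in `b, b + 1, b`; moving its last two letters to the front realigns the pairs. -/
theorem oddMorseCycle_concat (w : List (Fin 2)) (b : Fin 2) :
    oddMorseCycle (w ++ [b]) b = oddMorseCycle ((b + 1) :: w) b := by
  have := List.coe_cycle_append_comm (morseMap w ++ [b]) [b + 1, b]
  simpa [oddMorseCycle, morseMap_append, morseMap_cons, morseMap_nil,
    Fin.two_add_one_add_one] using this

theorem oddMorseCycle_concat_add_one (w : List (Fin 2)) (c : Fin 2) :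
    oddMorseCycle (w ++ [c + 1]) (c + 1) = oddMorseCycle (c :: w) (c + 1) := by
  rw [oddMorseCycle_concat, Fin.two_add_one_add_one]

theorem morseMap_wordBlock_succ' (q k : ℕ) : morseMap (wordBlock thueMorse q (k + 1)) =
    morseMap (wordBlock thueMorse q k) ++ [thueMorse (q + k), thueMorse (q + k) + 1] := by
  rw [wordBlock_succ', morseMap_append]
  rfl

theorem coe_wordBlock_even_odd (q m : ℕ) :
    ((wordBlock thueMorse (2 * q) (2 * m + 1) : List (Fin 2)) : Cycle (Fin 2)) =
      oddMorseCycle (wordBlock thueMorse q m) (thueMorse (q + m)) := by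
  rw [wordBlock_even_odd]
  rfl

theorem coe_wordBlock_odd_odd (q m : ℕ) :
    ((wordBlock thueMorse (2 * q + 1) (2 * m + 1) : List (Fin 2)) : Cycle (Fin 2)) =
      oddMorseCycle (wordBlock thueMorse (q + 1) m) (thueMorse q + 1) := by
  rw [wordBlock_odd_odd]
  exact List.coe_cycle_append_comm [_] _

/-! ### Even lengths -/

/-- At position `2q + 1`, rotating the first letter to the end gives an image when `t (q + m) = t
q`; otherwise the block of length `m + 1` at `q` indexes the class. -/
theorem cyclicComplexity_two_mul_le (m : ℕ) (hm : 1 ≤ m) : cyclicComplexity thueMorse (2 * m) ≤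
    cyclicComplexity thueMorse m + (borderedFactors 1 m).ncard := by
  refine Set.ncard_le_of_subset_image_union (cyclicFactors_finite thueMorse m)
    (borderedFactors_finite 1 m)
    (Quotient.map morseMap fun _ _ h => morseMap_isRotated h)
    (fun z => (((morseMap z).tail.dropLast : List (Fin 2)) : Cycle (Fin 2))) ?_
  rintro _ ⟨_, ⟨i, rfl⟩, rfl⟩
  obtain ⟨m, rfl⟩ := Nat.exists_eq_add_of_le' hm
  obtain ⟨q, rfl | rfl⟩ := Nat.even_or_odd' i
  · refine Or.inl ⟨_, ⟨_, ⟨q, rfl⟩, rfl⟩, ?_⟩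
    simp only [wordBlock_even_even]
    rfl
  · simp only [wordBlock_odd_even]
    rcases Fin.two_eq_or_eq_add_one (thueMorse (q + (m + 1))) (thueMorse q) with h | h
    · refine Or.inl ⟨_, ⟨_, ⟨q + 1, rfl⟩, rfl⟩, ?_⟩
      have := List.coe_cycle_append_comm [thueMorse q + 1]
        (morseMap (wordBlock thueMorse (q + 1) m) ++ [thueMorse q])
      rw [← add_assoc] at h
      rw [h]
      refine Eq.trans ?_ this.symm
      change ((morseMap _ : List (Fin 2)) : Cycle (Fin 2)) = _
      rw [wordBlock_succ', morseMap_append, morseMap_cons, morseMap_nil,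
        show q + 1 + m = q + m + 1 by ring, h]
      simp
    · refine Or.inr ⟨_, ⟨q, h, rfl⟩, ?_⟩
      dsimp only
      congr 1
      rw [wordBlock_succ, wordBlock_succ']
      simp only [morseMap_cons, morseMap_append, morseMap_nil, List.tail_cons]
      rw [← List.cons_append, List.append_cons, List.dropLast_concat]
      simp [Nat.add_assoc, Nat.add_comm]

/-! ### Lengths 3 mod 4 -/

theorem wordBlock_add_two (i j : ℕ) : wordBlock thueMorse i (j + 2) =
    thueMorse i :: (wordBlock thueMorse (i + 1) j ++ [thueMorse (i + 1 + j)]) := by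
  rw [wordBlock_succ, wordBlock_succ']

/-- The classes of factors of length `4 * j + 3`: those represented by `z ∈ wordFactors (j + 1)`. -/
def plainCycle (z : List (Fin 2)) : Cycle (Fin 2) :=
  oddMorseCycle (morseMap z.dropLast ++ [z.getLastD 0]) (z.getLastD 0 + 1)

theorem plainCycle_concat (u : List (Fin 2)) (c : Fin 2) :
    plainCycle (u ++ [c]) = oddMorseCycle (morseMap u ++ [c]) (c + 1) := by
  simp [plainCycle]

/-- The classes of factors of length `4 * j + 3` represented by `z ∈ borderedFactors 1 j`. -/
def unequalCycle (z : List (Fin 2)) : Cycle (Fin 2) :=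
  oddMorseCycle ((z.headD 0 + 1) :: (morseMap z.tail.dropLast ++
    [z.getLastD 0, z.getLastD 0 + 1])) (z.getLastD 0)

theorem unequalCycle_cons_concat (x : Fin 2) (u : List (Fin 2)) (c : Fin 2) :
    unequalCycle (x :: (u ++ [c])) =
      oddMorseCycle ((x + 1) :: (morseMap u ++ [c, c + 1])) c := by
  have : (x :: (u ++ [c])).getLastD 0 = c := by
    rw [← List.cons_append, List.getLastD_concat]
  simp only [unequalCycle, this, List.headD_cons, List.tail_cons, List.dropLast_concat]

/-- The classes of factors of length `4 * j + 3` represented by `z ∈ borderedFactors 0 (j + 1)`. -/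
def equalCycle (z : List (Fin 2)) : Cycle (Fin 2) :=
  -- In use `z` has at least three letters, so no default value occurs.
  if z.tail.dropLast.getLastD 0 = z.headD 0 then
    oddMorseCycle ((z.headD 0 + 1) ::
      (morseMap z.tail.dropLast.dropLast ++ [z.headD 0, z.headD 0 + 1])) (z.headD 0)
  else
    oddMorseCycle ((z.headD 0 + 1) :: (z.headD 0 + 1) ::
      (morseMap z.tail.dropLast.dropLast ++ [z.headD 0 + 1])) (z.headD 0)

theorem equalCycle_of_eq (u : List (Fin 2)) (c d : Fin 2) :
    equalCycle (c :: (u ++ [c] ++ [d])) =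
      oddMorseCycle ((c + 1) :: (morseMap u ++ [c, c + 1])) c := by
  simp only [equalCycle, List.tail_cons, List.dropLast_concat, List.getLastD_concat,
    List.headD_cons, if_true]

theorem equalCycle_of_ne (u : List (Fin 2)) (c d : Fin 2) :
    equalCycle (c :: (u ++ [c + 1] ++ [d])) =
      oddMorseCycle ((c + 1) :: (c + 1) :: (morseMap u ++ [c + 1])) c := by
  have : c + 1 ≠ c := by simp
  simp only [equalCycle, List.tail_cons, List.dropLast_concat, List.getLastD_concat,
    List.headD_cons, if_neg this]

/-- At position `4q + 2` put `x = t q`, `c = t (q + j)`, `y = t (q + j + 1)`: the class is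
`equalCycle` if `x = y`, `unequalCycle` if `y = c ≠ x`, `plainCycle` if `x = c ≠ y`. The other
residues fall into the same families. -/
theorem cyclicComplexity_four_mul_add_three_le (j : ℕ) (hj : 1 ≤ j) :
    cyclicComplexity thueMorse (4 * j + 3) ≤ (wordFactors thueMorse (j + 1)).ncard +
      (borderedFactors 1 j).ncard + (borderedFactors 0 (j + 1)).ncard := by
  obtain ⟨k, rfl⟩ := Nat.exists_eq_add_of_le' hj
  have hP := wordFactors_finite thueMorse (k + 1 + 1)
  have hD := borderedFactors_finite 1 (k + 1)
  have hT := borderedFactors_finite 0 (k + 1 + 1)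
  suffices h : cyclicFactors thueMorse (4 * (k + 1) + 3) ⊆
      plainCycle '' wordFactors thueMorse (k + 1 + 1) ∪
      (unequalCycle '' borderedFactors 1 (k + 1) ∪
        equalCycle '' borderedFactors 0 (k + 1 + 1)) by
    refine (Set.ncard_le_ncard h
      ((hP.image _).union ((hD.image _).union (hT.image _)))).trans ?_
    refine (Set.ncard_union_le _ _).trans ?_
    have := Set.ncard_union_le (unequalCycle '' borderedFactors 1 (k + 1))
      (equalCycle '' borderedFactors 0 (k + 1 + 1))
    have := Set.ncard_image_le (f := plainCycle) hP
    have := Set.ncard_image_le (f := unequalCycle) hD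
    have := Set.ncard_image_le (f := equalCycle) hT
    omega
  have plain : ∀ q, oddMorseCycle (morseMap (wordBlock thueMorse q (k + 1)) ++
      [thueMorse (q + (k + 1))]) (thueMorse (q + (k + 1)) + 1) ∈
      plainCycle '' wordFactors thueMorse (k + 1 + 1) := fun q =>
    ⟨_, ⟨q, rfl⟩, by rw [wordBlock_succ', plainCycle_concat]⟩
  have plain' : ∀ q c, thueMorse q = c → thueMorse (q + 1 + k) = c →
      oddMorseCycle ((c + 1) :: (morseMap (wordBlock thueMorse (q + 1) k) ++ [c, c + 1])) (c + 1) ∈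
      plainCycle '' wordFactors thueMorse (k + 1 + 1) := by
    intro q c h h'
    have := plain q
    rw [wordBlock_succ, morseMap_cons, h, show q + (k + 1) = q + 1 + k by ring, h'] at this
    rw [List.append_cons, ← List.cons_append, oddMorseCycle_concat_add_one]
    exact this
  have unequal : ∀ q c, thueMorse q = c + 1 → thueMorse (q + 1 + k) = c →
      oddMorseCycle (c :: (morseMap (wordBlock thueMorse (q + 1) k) ++ [c, c + 1])) c ∈
      unequalCycle '' borderedFactors 1 (k + 1) := by
    intro q c h h'
    refine ⟨_, ⟨q, ?_, rfl⟩, ?_⟩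
    · rw [show q + (k + 1) = q + 1 + k by ring, h, h', Fin.two_add_one_add_one]
    · rw [wordBlock_add_two, unequalCycle_cons_concat, h, h', Fin.two_add_one_add_one]
  have equal_eq : ∀ q c, thueMorse q = c → thueMorse (q + 1 + k) = c →
      thueMorse (q + 1 + (k + 1)) = c →
      oddMorseCycle ((c + 1) :: (morseMap (wordBlock thueMorse (q + 1) k) ++ [c, c + 1])) c ∈
      equalCycle '' borderedFactors 0 (k + 1 + 1) := by
    intro q c h h' h''
    refine ⟨_, ⟨q, ?_, rfl⟩, ?_⟩
    · rw [show q + (k + 1 + 1) = q + 1 + (k + 1) by ring, h, h'', add_zero]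
    · rw [wordBlock_add_two, wordBlock_succ', h, h', equalCycle_of_eq]
  have equal_ne : ∀ q c, thueMorse q = c → thueMorse (q + 1 + k) = c + 1 →
      thueMorse (q + 1 + (k + 1)) = c →
      oddMorseCycle ((c + 1) :: (morseMap (wordBlock thueMorse (q + 1) k) ++ [c + 1, c])) c ∈
      equalCycle '' borderedFactors 0 (k + 1 + 1) := by
    intro q c h h' h''
    refine ⟨_, ⟨q, ?_, rfl⟩, ?_⟩
    · rw [show q + (k + 1 + 1) = q + 1 + (k + 1) by ring, h, h'', add_zero]
    · rw [wordBlock_add_two, wordBlock_succ', h, h', equalCycle_of_ne,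
        ← oddMorseCycle_concat]
      simp
  rintro _ ⟨_, ⟨i, rfl⟩, rfl⟩
  simp only [show 4 * (k + 1) + 3 = 2 * (2 * (k + 1) + 1) + 1 by ring]
  obtain ⟨i, rfl | rfl⟩ := Nat.even_or_odd' i <;> obtain ⟨q, rfl | rfl⟩ := Nat.even_or_odd' i
  · rw [coe_wordBlock_even_odd, wordBlock_even_odd,
      show 2 * q + (2 * (k + 1) + 1) = 2 * (q + (k + 1)) + 1 by ring, thueMorse_two_mul_add_one]
    exact Or.inl (plain q)
  · rw [coe_wordBlock_even_odd, wordBlock_odd_odd, morseMap_wordBlock_succ',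
      show 2 * q + 1 + (2 * (k + 1) + 1) = 2 * (q + 1 + (k + 1)) by ring, thueMorse_two_mul]
    generalize hc : thueMorse (q + 1 + k) = c
    rcases Fin.two_eq_or_eq_add_one (thueMorse (q + 1 + (k + 1))) c with hy | hy <;>
      rcases Fin.two_eq_or_eq_add_one (thueMorse q) c with hx | hx <;> rw [hy, hx]
    · exact Or.inr (Or.inr (equal_eq q c hx hc hy))
    · rw [Fin.two_add_one_add_one]
      exact Or.inr (Or.inl (unequal q c hx hc))
    · exact Or.inl (plain' q c hx hc)
    · have := equal_ne q (c + 1) hx (by rw [hc, Fin.two_add_one_add_one]) hy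
      rw [Fin.two_add_one_add_one] at this ⊢
      exact Or.inr (Or.inr this)
  · rw [coe_wordBlock_odd_odd, wordBlock_odd_odd, morseMap_wordBlock_succ', thueMorse_two_mul]
    generalize hc : thueMorse (q + 1 + k) = c
    rcases Fin.two_eq_or_eq_add_one (thueMorse q) c with hx | hx <;> rw [hx]
    · exact Or.inl (plain' q c hx hc)
    · rw [Fin.two_add_one_add_one]
      exact Or.inr (Or.inl (unequal q c hx hc))
  · rw [coe_wordBlock_odd_odd, show 2 * q + 1 + 1 = 2 * (q + 1) by ring, wordBlock_even_odd,
      thueMorse_two_mul_add_one, Fin.two_add_one_add_one]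
    rcases Fin.two_eq_or_eq_add_one (thueMorse q) (thueMorse (q + 1 + (k + 1))) with hx | hx
    · rw [← hx, oddMorseCycle_concat, morseMap_wordBlock_succ']
      generalize hc : thueMorse q = c at hx ⊢
      rcases Fin.two_eq_or_eq_add_one (thueMorse (q + 1 + k)) c with hd | hd <;> rw [hd]
      · exact Or.inr (Or.inr (equal_eq q c hc hd hx.symm))
      · rw [Fin.two_add_one_add_one]
        exact Or.inr (Or.inr (equal_ne q c hc hd hx.symm))
    · rw [hx]
      exact Or.inl (plain (q + 1))

/-! ### Lengths 1 mod 4 -/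

/-- The classes of factors of length `4 * j + 1` represented by `z ∈ borderedFactors 0 j`. -/
def closedCycle (z : List (Fin 2)) : Cycle (Fin 2) :=
  oddMorseCycle ((z.headD 0 + 1) :: (morseMap z.tail.dropLast ++ [z.headD 0])) (z.headD 0 + 1)

theorem closedCycle_cons_concat (c d : Fin 2) (u : List (Fin 2)) :
    closedCycle (c :: (u ++ [d])) = oddMorseCycle ((c + 1) :: (morseMap u ++ [c])) (c + 1) := by
  simp [closedCycle]

theorem cyclicComplexity_four_mul_add_one_le (j : ℕ) (hj : 1 ≤ j) :
    cyclicComplexity thueMorse (4 * j + 1) ≤ (borderedFactors 0 j).ncard +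
      (wordFactors thueMorse (j + 1)).ncard + (borderedFactors 1 (j + 1)).ncard := by
  obtain ⟨k, rfl⟩ := Nat.exists_eq_add_of_le' hj
  have hS := borderedFactors_finite 0 (k + 1)
  have hP := wordFactors_finite thueMorse (k + 1 + 1)
  have hE := borderedFactors_finite 1 (k + 1 + 1)
  let f : List (Fin 2) → Cycle (Fin 2) := fun z => oddMorseCycle (morseMap z.tail) (z.headD 0)
  let g : List (Fin 2) → Cycle (Fin 2) := fun z =>
    oddMorseCycle (morseMap z.tail.dropLast) (z.headD 0 + 1)
  suffices h : cyclicFactors thueMorse (4 * (k + 1) + 1) ⊆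
      closedCycle '' borderedFactors 0 (k + 1) ∪
      (f '' wordFactors thueMorse (k + 1 + 1) ∪ g '' borderedFactors 1 (k + 1 + 1)) by
    refine (Set.ncard_le_ncard h
      ((hS.image _).union ((hP.image _).union (hE.image _)))).trans ?_
    refine (Set.ncard_union_le _ _).trans ?_
    have := Set.ncard_union_le (f '' wordFactors thueMorse (k + 1 + 1))
      (g '' borderedFactors 1 (k + 1 + 1))
    have := Set.ncard_image_le (f := closedCycle) hS
    have := Set.ncard_image_le (f := f) hP
    have := Set.ncard_image_le (f := g) hE
    omega
  have plain : ∀ q, oddMorseCycle (morseMap (wordBlock thueMorse (q + 1) (k + 1)))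
      (thueMorse q) ∈ f '' wordFactors thueMorse (k + 1 + 1) := fun q =>
    ⟨_, ⟨q, rfl⟩, by rw [wordBlock_succ]; rfl⟩
  -- The inserted letter follows the block; if it equals the letter preceding the block, the class
  -- is already counted by `f`.
  have aligned : ∀ q, oddMorseCycle (morseMap (wordBlock thueMorse (q + 1) (k + 1)))
      (thueMorse (q + 1 + (k + 1))) ∈
      f '' wordFactors thueMorse (k + 1 + 1) ∪ g '' borderedFactors 1 (k + 1 + 1) := by
    intro q
    rcases Fin.two_eq_or_eq_add_one (thueMorse (q + 1 + (k + 1))) (thueMorse q) with h | h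
    · rw [h]
      exact Or.inl (plain q)
    · refine Or.inr ⟨_, ⟨q, by rw [← h]; congr 1; ring, rfl⟩, ?_⟩
      rw [wordBlock_add_two, h]
      simp [g]
  have closed : ∀ q c, thueMorse q = c → thueMorse (q + 1 + k) = c →
      oddMorseCycle ((c + 1) :: (morseMap (wordBlock thueMorse (q + 1) k) ++ [c])) (c + 1) ∈
      closedCycle '' borderedFactors 0 (k + 1) := by
    intro q c h h'
    refine ⟨_, ⟨q, ?_, rfl⟩, ?_⟩
    · rw [show q + (k + 1) = q + 1 + k by ring, h, h', add_zero]
    · rw [wordBlock_add_two, closedCycle_cons_concat, h]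
  rintro _ ⟨_, ⟨i, rfl⟩, rfl⟩
  -- A position at least 4 ensures that the desubstituted block has a preceding letter.
  obtain ⟨i, hi⟩ := exists_pos_wordBlock_eq i (4 * (k + 1) + 1)
  dsimp only
  rw [hi, show 4 * (k + 1) + 1 = 2 * (2 * (k + 1)) + 1 by ring]
  clear hi
  obtain ⟨i, rfl | rfl⟩ := Nat.even_or_odd' i <;> obtain ⟨q, rfl | rfl⟩ := Nat.even_or_odd' i
  · rw [show 2 * (2 * q) + 4 = 2 * (2 * (q + 1)) by ring, coe_wordBlock_even_odd,
      wordBlock_even_even, ← mul_add, thueMorse_two_mul]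
    exact Or.inr (aligned q)
  · rw [show 2 * (2 * q + 1) + 4 = 2 * (2 * (q + 1) + 1) by ring, coe_wordBlock_even_odd,
      show 2 * (q + 1) + 1 + 2 * (k + 1) = 2 * (q + 1 + 1 + k) + 1 by ring,
      wordBlock_odd_even, thueMorse_two_mul_add_one,
      show q + 1 + k + 1 = q + 1 + 1 + k by ring]
    generalize q + 1 = q
    generalize hc : thueMorse (q + 1 + k) = c
    rcases Fin.two_eq_or_eq_add_one (thueMorse q) c with hx | hx <;> rw [hx]
    · exact Or.inl (closed q c hx hc)
    · refine Or.inr (Or.inl ?_)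
      have := plain q
      rw [morseMap_wordBlock_succ', hc, hx, List.append_cons, oddMorseCycle_concat_add_one] at this
      rwa [Fin.two_add_one_add_one]
  · rw [show 2 * (2 * q) + 1 + 4 = 2 * (2 * (q + 1)) + 1 by ring, coe_wordBlock_odd_odd,
      wordBlock_odd_even, thueMorse_two_mul, show q + 1 + k + 1 = q + 1 + 1 + k by ring]
    generalize hc : thueMorse (q + 1 + 1 + k) = c
    rcases Fin.two_eq_or_eq_add_one (thueMorse (q + 1)) c with hx | hx <;> rw [hx]
    · exact Or.inl (closed (q + 1) c hx hc)
    · refine Or.inr ?_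
      have := aligned q
      rw [wordBlock_succ, morseMap_cons, hx, show q + 1 + (k + 1) = q + 1 + 1 + k by ring, hc,
        Fin.two_add_one_add_one] at this
      rwa [Fin.two_add_one_add_one, ← List.cons_append, oddMorseCycle_concat]
  · rw [show 2 * (2 * q + 1) + 1 + 4 = 2 * (2 * (q + 1) + 1) + 1 by ring, coe_wordBlock_odd_odd,
      show 2 * (q + 1) + 1 + 1 = 2 * (q + 1 + 1) by ring, wordBlock_even_even,
      thueMorse_two_mul_add_one, Fin.two_add_one_add_one]
    exact Or.inr (Or.inl (plain (q + 1)))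

/-! ### Short lengths and conclusion -/

/-- The class of the block of length `n` in position `16 * q + r`, as a function of `t q`,
`t (q + 1)` and `r`. -/
def shortCycle (n : ℕ) (p : Fin 2 × Fin 2 × Fin 16) : Cycle (Fin 2) :=
  ((wordBlock (fun i => if i < 16 then p.1 + thueMorse i else p.2.1 + thueMorse (i - 16))
    p.2.2 n : List (Fin 2)) : Cycle (Fin 2))

/-- With offset at most 15 and length at most 17, a block meets at most two aligned 16-blocks. -/
theorem cyclicComplexity_le_card_image_shortCycle (n : ℕ) (hn : n ≤ 17) :
    cyclicComplexity thueMorse n ≤ (Finset.univ.image (shortCycle n)).card := by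
  rw [cyclicComplexity, ← Set.ncard_coe_finset]
  refine Set.ncard_le_ncard ?_ (Finset.finite_toSet _)
  rintro _ ⟨_, ⟨i, rfl⟩, rfl⟩
  rw [Finset.coe_image, Finset.coe_univ, Set.image_univ]
  refine ⟨(thueMorse (i / 16), thueMorse (i / 16 + 1), ⟨i % 16, Nat.mod_lt _ (by norm_num)⟩), ?_⟩
  refine congrArg _ (wordBlock_congr _ fun k hk => ?_)
  dsimp only
  split_ifs with h
  · rw [← thueMorse_two_pow_mul_add 4 _ _ h]
    congr 1
    omega
  · rw [← thueMorse_two_pow_mul_add 4 _ _ (by omega)]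
    congr 1
    omega

theorem cyclicComplexity_thueMorse_le {n : ℕ} (hn : 3 ≤ n) :
    cyclicComplexity thueMorse n ≤ 2 * n - 4 := by
  induction n using Nat.strong_induction_on with
  | _ n ih =>
    -- Length 4 would halve to 2, length 3 is `j = 0`, and 5 and 13 are `4j + 1` with `j = 1, 3`.
    by_cases hsmall : n = 3 ∨ n = 4 ∨ n = 5 ∨ n = 13
    · refine (cyclicComplexity_le_card_image_shortCycle n (by omega)).trans ?_
      rcases hsmall with rfl | rfl | rfl | rfl <;> decide +kernel
    · obtain ⟨m, rfl | rfl⟩ := Nat.even_or_odd' n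
      · have := cyclicComplexity_two_mul_le m (by omega)
        have := ih m (by omega) (by omega)
        have := ncard_borderedFactors_le 1 m (by omega)
        omega
      · obtain ⟨j, rfl | rfl⟩ := Nat.even_or_odd' m
        · have h := cyclicComplexity_four_mul_add_one_le j (by omega)
          have := ncard_wordFactors_le j
          have := ncard_borderedFactors_sum_le j (by omega) (by omega)
          rw [show 2 * (2 * j) + 1 = 4 * j + 1 by ring]
          omega
        · have h := cyclicComplexity_four_mul_add_three_le j (by omega)
          have := ncard_wordFactors_le j
          have := ncard_borderedFactors_le 0 j (by omega)
          have := ncard_borderedFactors_le 1 j (by omega)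
          have := ncard_borderedFactors_le 0 (j + 1) (by omega)
          rw [show 2 * (2 * j + 1) + 1 = 4 * j + 3 by ring]
          omega

theorem theorem3 (n : ℕ) (hn : 3 ≤ n) :
    (cyclicComplexity thueMorse n : ℤ) ≤ 2 * (n : ℤ) - 4 := by
  have := cyclicComplexity_thueMorse_le hn
  omega
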